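/- Let $A$ be an ordered Banach algebra, i.e. a complex Banach algebra with unit $\mathbf e$ and a closed convex (proper) cone $A^+$ such that $\mathbf e\in A^+$ and $A^+A^+\subseteq A^+$; write $x\le y$ for $y-x\in A^+$, and $x<y$ if also $x\neq y$. Let $r(x)$, $\sigma(x)$ and $R(\lambda,x)=(\lambda-x)^{-1}$ denote the spectral radius, the spectrum and the resolvent of $x$. Let $\mathbf{OI}(A)=\{p\in A: p^2=p,\ 0\le p\le\mathbf e\}$ be the Boolean algebra of order idempotents. A positive element $x$ is order continuous, $x\in A_{\rm n}$, if for every net $p_\alpha\downarrow0$ in $\mathbf{OI}(A)$ both $p_\alpha x\downarrow 0$ and $xp_\alpha\downarrow0$ in $A$. Assume (A$_1$) $A_{\rm n}A_{\rm n}\subseteq A_{\rm n}$; whenever $x,y\in A_{\rm n}$ and $xy=0$ there is $p\in\mathbf{OI}(A)$ with $xp=0=(\mathbf e-p)y$; $\mathbf{OI}(A)$ is Dedekind complete; and $A_{\rm n}$ is norm closed in $A$. Assume also that the cone $A^+$ is normal: there is a constant $C$ such that $0\le x\le y$ implies $\|x\|\le C\|y\|$. Let $a,b\in A$ satisfy $0\le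 b<a$, where $a$ is order continuous and irreducible (that is, $(\mathbf e-p)ap=0$ with $p\in\mathbf{OI}(A)$ implies $p=0$ or $p=\mathbf e$), and suppose that $r(a)$ is a pole of $R(\cdot,a)$. Let $a_{-1}$ be the residue of $R(\cdot,a)$ at $r(a)$. Then each of the following conditions guarantees $r(b)<r(a)$: (a) $A$ is a Fredholm algebra and $r(a)-a\in\Phi(A)$. Here $A$ is called a Fredholm algebra if there are given an open set $\Phi(A)\subseteq A$ with $\Phi(A)=-\Phi(A)$ and functions $\mathrm{nul},\mathrm{def}:A\to\mathbb N\cup\{0,\pm\infty\}$ with $\mathrm{nul}(-x)=\mathrm{nul}(x)$ and $\mathrm{def}(-x)=\mathrm{def}(x)$ for all $x$, such that $x$ is invertible if and only if $\mathrm{nul}(x)=\mathrm{def}(x)=0$, and such that for every $x\in\Phi(A)$ there is $\epsilon>0$ for which $\mathrm{nul}(\lambda-x)$ and $\mathrm{def}(\lambda-x)$ are constant on $\{\lambda\in\mathbb C:0<|\lambda|<\epsilon\}$. (b) There is an inessential ideal $J$ of $A$ with $a_{-1}\in J$. Here a two-sided algebraic ideal $J$ is inessential if for each $x\in J$ zero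 is the only possible accumulation point of $\sigma(x)$. (c) The ideal $\mathcal F(A)$ of finite-rank elements is inessential. Here $\mathcal F(A)$ is the two-sided algebraic ideal generated by all order continuous idempotents $x\in A$ for which there is a non-zero $q\in\mathbf{OI}(A)$ with $qxq=x$ and $q_1xq_2>0$ for all non-zero $q_1,q_2\in\mathbf{OI}(A)$ with $q_1,q_2\le q$. -/

import Mathlib

open Set Topology Filter

namespace OBA

/-!
An ordered Banach algebra is a complex Banach algebra `A` with unit, with a partial order such that
`[IsOrderedRing A]` (the positive elements are closed under sums and products, the unit is
positive), `[PosSMulMono ℝ A]` (they are closed under multiplication by nonnegative reals) and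
`[OrderClosedTopology A]` (the cone of positive elements is closed).
-/

section Order

variable (A : Type*) [NormedRing A] [PartialOrder A]

/-- The set `OI(A)` of order idempotents: `0 ≤ p ≤ e` and `p ^ 2 = p`. -/
def orderIdempotents : Set A := {p | 0 ≤ p ∧ p ≤ 1 ∧ p * p = p}

/-- The cone `A⁺` is normal. -/
def NormalCone : Prop := ∃ C : ℝ, ∀ x y : A, 0 ≤ x → x ≤ y → ‖x‖ ≤ C * ‖y‖

/-- Dedekind completeness of `OI(A)`, with the order inherited from `A`; the suprema are
taken in `OI(A)`. -/
def OIDedekindComplete : Prop :=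
  ∀ S : Set (orderIdempotents A), S.Nonempty → BddAbove S → ∃ s, IsLUB S s

variable [IsOrderedRing A]

instance : Zero (orderIdempotents A) := ⟨⟨0, le_refl 0, zero_le_one, mul_zero 0⟩⟩

/-- The set `A_n` of order continuous elements: positive `a` such that `p_α ↓ 0` in `OI(A)` implies
`p_α a ↓ 0` and `a p_α ↓ 0` in `A`. A decreasing net enters only through its range, a nonempty
downward directed set, so that the condition is stated for such sets; the images are again
downward directed because `a` is positive. -/
def orderContinuous : Set A :=
  {a | 0 ≤ a ∧ ∀ D : Set (orderIdempotents A), D.Nonempty → DirectedOn (· ≥ ·) D → IsGLB D 0 →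
    IsGLB ((fun p : orderIdempotents A => (p : A) * a) '' D) 0 ∧
    IsGLB ((fun p : orderIdempotents A => a * (p : A)) '' D) 0}

/-- Axiom (A₁). -/
structure AxiomA1 : Prop where
  /-- `A` is order regular: `A_n` is a multiplicative subsemigroup. -/
  orderRegular : ∀ a ∈ orderContinuous A, ∀ b ∈ orderContinuous A, a * b ∈ orderContinuous A
  /-- `A` has a disjunctive product. -/
  disjunctiveProduct : ∀ a ∈ orderContinuous A, ∀ b ∈ orderContinuous A, a * b = 0 →
    ∃ p ∈ orderIdempotents A, a * p = 0 ∧ (1 - p) * b = 0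
  /-- The Boolean algebra `OI(A)` is Dedekind complete. -/
  dedekindComplete : OIDedekindComplete A
  /-- `A_n` is closed in norm. -/
  isClosed : IsClosed (orderContinuous A)

variable {A}

/-- `a` is positive and has no non-trivial invariant order idempotents. -/
def IrreducibleElt (a : A) : Prop :=
  0 ≤ a ∧ ∀ p ∈ orderIdempotents A, (1 - p) * a * p = 0 → p = 0 ∨ p = 1

/-- `b` is relatively algebraically strictly positive: for some non-zero order idempotent `q`
one has `b ∈ A(q)`, i.e. `q b q = b`, and `q₁ b q₂ > 0` for all non-zero order idempotents
`q₁, q₂ ≤ q`. -/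
def RelAlgStrictlyPositive (b : A) : Prop :=
  ∃ q ∈ orderIdempotents A, q ≠ 0 ∧ q * b * q = b ∧
    ∀ q₁ ∈ orderIdempotents A, ∀ q₂ ∈ orderIdempotents A,
      0 < q₁ → q₁ ≤ q → 0 < q₂ → q₂ ≤ q → 0 < q₁ * b * q₂

variable (A)

/-- The two-sided ideal of finite-rank elements, generated by the order continuous
relatively algebraically strictly positive idempotents. -/
def finiteRank : TwoSidedIdeal A :=
  TwoSidedIdeal.span {b | RelAlgStrictlyPositive b ∧ b * b = b ∧ b ∈ orderContinuous A}

end Order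

section Banach

variable {B : Type*} [NormedRing B] [NormedAlgebra ℂ B]

/-- The spectral radius, as a real number. -/
noncomputable def specRad (b : B) : ℝ := (spectralRadius ℂ b).toReal

/-- `c` is the family of Laurent coefficients of the resolvent `R(z, b) = (z - b)⁻¹` at `z₀`:
the expansion holds in a punctured neighbourhood of `z₀` in the resolvent set. -/
def IsLaurentExpansion (b : B) (z₀ : ℂ) (c : ℤ → B) : Prop :=
  ∃ δ > 0, ∀ z : ℂ, 0 < ‖z - z₀‖ → ‖z - z₀‖ < δ →
    z ∈ resolventSet ℂ b ∧ HasSum (fun j : ℤ => (z - z₀) ^ j • c j) (resolvent b z)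

/-- `z₀` is a pole of the resolvent of `b` (isolatedness in the spectrum is part of
`IsLaurentExpansion`). -/
def IsPole (b : B) (z₀ : ℂ) : Prop :=
  z₀ ∈ spectrum ℂ b ∧ ∃ c : ℤ → B, IsLaurentExpansion b z₀ c ∧
    ∃ k : ℕ, 1 ≤ k ∧ (∀ j : ℤ, j < -(k : ℤ) → c j = 0) ∧ c (-(k : ℤ)) ≠ 0

/-- `x` is the residue of the resolvent of `b` at `z₀`. -/
def IsResidue (b : B) (z₀ : ℂ) (x : B) : Prop :=
  ∃ c : ℤ → B, IsLaurentExpansion b z₀ c ∧ c (-1) = x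

/-- A two-sided ideal is inessential if zero is the only possible accumulation point of the
spectrum of each of its elements. -/
def Inessential (J : TwoSidedIdeal B) : Prop :=
  ∀ b ∈ J, ∀ z : ℂ, AccPt z (𝓟 (spectrum ℂ b)) → z = 0

variable (B)

/-- The data that make a unital Banach algebra a Fredholm algebra. The functions `nul` and `dfc`
(the defect) take values in `ℕ ∪ {±∞}`. -/
structure FredholmAlgebra where
  /-- The set of Fredholm elements. -/
  Phi : Set B
  isOpen_Phi : IsOpen Phi
  neg_Phi : ∀ b, -b ∈ Phi ↔ b ∈ Phi
  /-- The nullity. -/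
  nul : B → WithBot ℕ∞
  /-- The defect. -/
  dfc : B → WithBot ℕ∞
  nul_neg : ∀ b, nul (-b) = nul b
  dfc_neg : ∀ b, dfc (-b) = dfc b
  isUnit_iff : ∀ b, IsUnit b ↔ nul b = 0 ∧ dfc b = 0
  /-- The punctured neighbourhood property. -/
  punctured : ∀ b ∈ Phi, ∃ ε > 0, ∃ m n : WithBot ℕ∞, ∀ z : ℂ, 0 < ‖z‖ → ‖z‖ < ε →
    nul (algebraMap ℂ B z - b) = m ∧ dfc (algebraMap ℂ B z - b) = n

end Banach

end OBA

namespace OBA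

/-! ### Order idempotents, order continuous elements and irreducibility. -/

section Order

variable {A : Type*} [NormedRing A] [PartialOrder A] [IsOrderedRing A]

/-! Write `r = r(a)` and `d = a - b`. The inequality, `specRad_lt_of_lt`, gives the conclusion in
all three cases. Irreducibility and the disjunctive product make products of order continuous
elements non-zero as soon as the left factor is a left eigenelement of `a`, or the right factor a
right one (`mul_ne_zero_of_eigen`, `mul_ne_zero_of_right_eigen`). Applied to the leading Laurent
coefficient, this forces the pole to be simple, and its residue `u` is a positive idempotent with `a
u = u a = r u` (`exists_residue_of_isPole`).

Positive elements of the corner `u A u` below multiples of `u` are thus free of zero divisors. A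
square root built by iteration, convergent because the cone is normal, splits an element between
`-u` and `u` into disjoint positive parts, so such an order interval consists of multiples of `u`
(`exists_eq_smul_of_no_zero_divisors`). Hence `u d u = α u` with `α ≠ 0`.

First-order perturbation then makes `r - (a - t d)` invertible for some `0 < t ≤ 1`
(`exists_isUnit_add_smul`). Since `b ≤ a - t d ≤ a`, positivity of the resolvent at `r` persists
slightly below `r` and bounds the powers of `b` (`specRad_lt_of_isUnit`). -/

theorem one_sub_mem_orderIdempotents {p : A} (hp : p ∈ orderIdempotents A) :
    1 - p ∈ orderIdempotents A := by
  refine ⟨sub_nonneg.2 hp.2.1, sub_le_self _ hp.1, ?_⟩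
  rw [mul_sub, sub_mul, sub_mul, hp.2.2]
  simp

theorem mul_eq_left_of_le {p q : A} (hp : p ∈ orderIdempotents A) (hq : q ∈ orderIdempotents A)
    (h : p ≤ q) : p * q = p := by
  have h1 : 0 ≤ 1 - q := sub_nonneg.2 hq.2.1
  have h2 : p * (1 - q) ≤ q * (1 - q) := mul_le_mul_of_nonneg_right h h1
  have h3 : 0 ≤ p * (1 - q) := mul_nonneg hp.1 h1
  rw [mul_sub, mul_sub, hq.2.2, mul_one, mul_one, sub_self] at h2
  rw [mul_sub, mul_one] at h3
  exact (sub_eq_zero.1 (le_antisymm h2 h3)).symm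

theorem mul_eq_right_of_le {p q : A} (hp : p ∈ orderIdempotents A) (hq : q ∈ orderIdempotents A)
    (h : p ≤ q) : q * p = p := by
  have h1 : 0 ≤ 1 - q := sub_nonneg.2 hq.2.1
  have h2 : (1 - q) * p ≤ (1 - q) * q := mul_le_mul_of_nonneg_left h h1
  have h3 : 0 ≤ (1 - q) * p := mul_nonneg h1 hp.1
  rw [sub_mul, sub_mul, hq.2.2, one_mul, one_mul, sub_self] at h2
  rw [sub_mul, one_mul] at h3
  exact (sub_eq_zero.1 (le_antisymm h2 h3)).symm

theorem orderIdempotents_mul_comm {p q : A} (hp : p ∈ orderIdempotents A)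
    (hq : q ∈ orderIdempotents A) : p * q = q * p := by
  have h1 : 0 ≤ 1 - p := sub_nonneg.2 hp.2.1
  have key1 : (1 - p) * q * p = 0 := by
    refine le_antisymm ?_ (mul_nonneg (mul_nonneg h1 hq.1) hp.1)
    have : (1 - p) * q * p ≤ (1 - p) * 1 * p :=
      mul_le_mul_of_nonneg_right (mul_le_mul_of_nonneg_left hq.2.1 h1) hp.1
    rwa [mul_one, sub_mul 1 p p, one_mul, hp.2.2, sub_self] at this
  have key2 : p * q * (1 - p) = 0 := by
    refine le_antisymm ?_ (mul_nonneg (mul_nonneg hp.1 hq.1) h1)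
    have : p * q * (1 - p) ≤ p * 1 * (1 - p) :=
      mul_le_mul_of_nonneg_right (mul_le_mul_of_nonneg_left hq.2.1 hp.1) h1
    rwa [mul_one, mul_sub p 1 p, mul_one, hp.2.2, sub_self] at this
  rw [sub_mul, one_mul, sub_mul, sub_eq_zero] at key1
  rw [mul_sub, mul_one, sub_eq_zero] at key2
  rw [key2, ← key1]

theorem sub_mem_orderIdempotents {p q : A} (hp : p ∈ orderIdempotents A)
    (hq : q ∈ orderIdempotents A) (h : p ≤ q) : q - p ∈ orderIdempotents A := by
  refine ⟨sub_nonneg.2 h, (sub_le_self _ hp.1).trans hq.2.1, ?_⟩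
  rw [mul_sub, sub_mul, sub_mul, hp.2.2, hq.2.2, mul_eq_left_of_le hp hq h,
    mul_eq_right_of_le hp hq h]
  abel

theorem sup_mem_orderIdempotents {p q : A} (hp : p ∈ orderIdempotents A)
    (hq : q ∈ orderIdempotents A) : p + q - p * q ∈ orderIdempotents A := by
  have h := orderIdempotents_mul_comm hp hq
  have h1 : 0 ≤ 1 - p := sub_nonneg.2 hp.2.1
  have e1 : p + q - p * q = p + (1 - p) * q := by noncomm_ring
  have e2 : p + q - p * q = 1 - (1 - p) * (1 - q) := by noncomm_ring
  refine ⟨?_, ?_, ?_⟩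
  · rw [e1]
    exact add_nonneg hp.1 (mul_nonneg h1 hq.1)
  · rw [e2]
    exact sub_le_self _ (mul_nonneg h1 (sub_nonneg.2 hq.2.1))
  · have hc : Commute (1 - p) (1 - q) := by
      have : Commute p q := h
      exact ((Commute.one_left _).sub_left (((Commute.one_right _).sub_right this)))
    have hpp := (one_sub_mem_orderIdempotents hp).2.2
    have hqq := (one_sub_mem_orderIdempotents hq).2.2
    have : ((1 - p) * (1 - q)) * ((1 - p) * (1 - q)) = (1 - p) * (1 - q) := by
      rw [hc.symm.mul_mul_mul_comm, hpp, hqq]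
    rw [e2]
    generalize (1 - p) * (1 - q) = m at this
    rw [mul_sub, sub_mul, sub_mul, this]
    simp

/-- A set of order idempotents which is nonempty and closed under finite suprema, together with
its supremum `s`: the differences `s - p` decrease to `0`. -/
theorem exists_isLUB_decreasing (hD : OIDedekindComplete A) (S : Set (orderIdempotents A))
    (h0 : S.Nonempty)
    (hS : ∀ p ∈ S, ∀ q ∈ S, (⟨_, sup_mem_orderIdempotents p.2 q.2⟩ : orderIdempotents A) ∈ S) :
    ∃ s : orderIdempotents A, IsLUB S s ∧ ∃ D : Set (orderIdempotents A),
      D.Nonempty ∧ DirectedOn (· ≥ ·) D ∧ IsGLB D 0 ∧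
        ∀ t ∈ D, ∃ p ∈ S, (t : A) = (s : A) - p := by
  obtain ⟨s, hs⟩ := hD S h0 ⟨⟨1, zero_le_one, le_refl _, mul_one 1⟩, fun p _ => p.2.2.1⟩
  refine ⟨s, hs, {t | ∃ p ∈ S, (t : A) = (s : A) - p}, ?_, ?_, ?_, fun t ht => ht⟩
  · obtain ⟨p, hp⟩ := h0
    exact ⟨⟨s - p, sub_mem_orderIdempotents p.2 s.2 (hs.1 hp)⟩, p, hp, rfl⟩
  · rintro t ⟨p, hp, htp⟩ t' ⟨q, hq, htq⟩
    refine ⟨⟨_, sub_mem_orderIdempotents (sup_mem_orderIdempotents p.2 q.2) s.2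
      (hs.1 (hS p hp q hq))⟩, ⟨_, hS p hp q hq, rfl⟩, ?_, ?_⟩
    · change (s : A) - (p + q - p * q) ≤ t
      rw [htp]
      refine sub_le_sub_left ?_ _
      have : (p : A) + q - p * q = p + (1 - p) * q := by noncomm_ring
      rw [this]
      exact le_add_of_nonneg_right (mul_nonneg (sub_nonneg.2 p.2.2.1) q.2.1)
    · change (s : A) - (p + q - p * q) ≤ t'
      rw [htq]
      refine sub_le_sub_left ?_ _
      have : (p : A) + q - p * q = q + p * (1 - q) := by noncomm_ring
      rw [this]
      exact le_add_of_nonneg_right (mul_nonneg p.2.1 (sub_nonneg.2 q.2.2.1))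
  · refine ⟨fun t _ => t.2.1, fun l hl => ?_⟩
    have hl' : ∀ p ∈ S, (l : A) ≤ s - p := fun p hp =>
      hl (show (⟨_, sub_mem_orderIdempotents p.2 s.2 (hs.1 hp)⟩ : orderIdempotents A) ∈ _ from
        ⟨p, hp, rfl⟩)
    have hls : (l : A) ≤ s := by
      obtain ⟨p, hp⟩ := h0
      exact (hl' p hp).trans (sub_le_self _ p.2.1)
    have : s ≤ ⟨_, sub_mem_orderIdempotents l.2 s.2 hls⟩ := by
      refine hs.2 fun p hp => ?_
      change (p : A) ≤ s - l
      exact le_sub_comm.1 (hl' p hp)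
    have h2 : (s : A) ≤ s - l := this
    exact (le_sub_self_iff _).1 h2

/-- The annihilating idempotents are closed under finite suprema. If `s` is their supremum, the
differences `s - p` decrease to `0` while `x * (s - p) = x * s`, so order continuity gives `x * s ≤
0`. -/
theorem exists_max_right_annihilator (hD : OIDedekindComplete A) {x : A}
    (hx : x ∈ orderContinuous A) :
    ∃ s ∈ orderIdempotents A, x * s = 0 ∧ ∀ p ∈ orderIdempotents A, x * p = 0 → p ≤ s := by
  obtain ⟨s, hs, D, hne, hdir, hglb, hDS⟩ :=
    exists_isLUB_decreasing hD {p | x * (p : A) = 0} ⟨0, mul_zero x⟩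
    (fun p hp q hq => by
      change x * _ = 0
      have hp' : x * (p : A) = 0 := hp
      have hq' : x * (q : A) = 0 := hq
      rw [mul_sub, mul_add, hp', hq', ← mul_assoc, hp']
      simp)
  refine ⟨s, s.2, ?_, fun p hp hxp => hs.1 (show (⟨p, hp⟩ : orderIdempotents A) ∈ _ from hxp)⟩
  refine le_antisymm ((hx.2 D hne hdir hglb).2.2 ?_) (mul_nonneg hx.1 s.2.1)
  rintro _ ⟨t, ht, rfl⟩
  obtain ⟨p, hp, htp⟩ := hDS t ht
  have hp' : x * (p : A) = 0 := hp
  simp [htp, mul_sub, hp']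

theorem exists_max_left_annihilator (hD : OIDedekindComplete A) {x : A}
    (hx : x ∈ orderContinuous A) :
    ∃ s ∈ orderIdempotents A, s * x = 0 ∧ ∀ p ∈ orderIdempotents A, p * x = 0 → p ≤ s := by
  obtain ⟨s, hs, D, hne, hdir, hglb, hDS⟩ :=
    exists_isLUB_decreasing hD {p | (p : A) * x = 0} ⟨0, zero_mul x⟩
    (fun p hp q hq => by
      change _ * x = 0
      have hp' : (p : A) * x = 0 := hp
      have hq' : (q : A) * x = 0 := hq
      rw [sub_mul, add_mul, hp', hq', mul_assoc, hq']
      simp)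
  refine ⟨s, s.2, ?_, fun p hp hxp => hs.1 (show (⟨p, hp⟩ : orderIdempotents A) ∈ _ from hxp)⟩
  refine le_antisymm ((hx.2 D hne hdir hglb).1.2 ?_) (mul_nonneg s.2.1 hx.1)
  rintro _ ⟨t, ht, rfl⟩
  obtain ⟨p, hp, htp⟩ := hDS t ht
  have hp' : (p : A) * x = 0 := hp
  simp [htp, sub_mul, hp']

theorem orderContinuous_of_le {x y : A} (hx : x ∈ orderContinuous A) (hy : 0 ≤ y) (h : y ≤ x) :
    y ∈ orderContinuous A := by
  refine ⟨hy, fun D hne hdir hglb => ⟨⟨?_, fun l hl => ?_⟩, ⟨?_, fun l hl => ?_⟩⟩⟩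
  · rintro _ ⟨p, _, rfl⟩
    exact mul_nonneg p.2.1 hy
  · refine (hx.2 D hne hdir hglb).1.2 ?_
    rintro _ ⟨p, hp, rfl⟩
    exact (hl ⟨p, hp, rfl⟩).trans (mul_le_mul_of_nonneg_left h p.2.1)
  · rintro _ ⟨p, _, rfl⟩
    exact mul_nonneg hy p.2.1
  · refine (hx.2 D hne hdir hglb).2.2 ?_
    rintro _ ⟨p, hp, rfl⟩
    exact (hl ⟨p, hp, rfl⟩).trans (mul_le_mul_of_nonneg_right h p.2.1)

theorem zero_mem_orderContinuous {x : A} (hx : x ∈ orderContinuous A) :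
    (0 : A) ∈ orderContinuous A :=
  orderContinuous_of_le hx le_rfl hx.1

theorem orderContinuous_add {x y : A} (hx : x ∈ orderContinuous A) (hy : y ∈ orderContinuous A) :
    x + y ∈ orderContinuous A := by
  refine ⟨add_nonneg hx.1 hy.1, fun D hne hdir hglb => ⟨⟨?_, fun l hl => ?_⟩, ⟨?_, fun l hl => ?_⟩⟩⟩
  · rintro _ ⟨p, _, rfl⟩
    exact mul_nonneg p.2.1 (add_nonneg hx.1 hy.1)
  · refine (hx.2 D hne hdir hglb).1.2 ?_
    rintro _ ⟨p, hp, rfl⟩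
    -- With `p` fixed, `l - p * x` is a lower bound of all `q * y`; directedness supplies `s` below
    -- both `p` and `q`.
    refine sub_nonpos.1 ((hy.2 D hne hdir hglb).1.2 ?_)
    rintro _ ⟨q, hq, rfl⟩
    obtain ⟨s, hs, hsp, hsq⟩ := hdir p hp q hq
    have h1 : l ≤ (s : A) * (x + y) := hl ⟨s, hs, rfl⟩
    have h2 : (s : A) * x ≤ p * x := mul_le_mul_of_nonneg_right hsp hx.1
    have h3 : (s : A) * y ≤ q * y := mul_le_mul_of_nonneg_right hsq hy.1
    rw [mul_add] at h1
    exact sub_le_iff_le_add'.2 (h1.trans (add_le_add h2 h3))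
  · rintro _ ⟨p, _, rfl⟩
    exact mul_nonneg (add_nonneg hx.1 hy.1) p.2.1
  · refine (hx.2 D hne hdir hglb).2.2 ?_
    rintro _ ⟨p, hp, rfl⟩
    refine sub_nonpos.1 ((hy.2 D hne hdir hglb).2.2 ?_)
    rintro _ ⟨q, hq, rfl⟩
    obtain ⟨s, hs, hsp, hsq⟩ := hdir p hp q hq
    have h1 : l ≤ (x + y) * (s : A) := hl ⟨s, hs, rfl⟩
    have h2 : x * (s : A) ≤ x * p := mul_le_mul_of_nonneg_left hsp hx.1
    have h3 : y * (s : A) ≤ y * q := mul_le_mul_of_nonneg_left hsq hy.1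
    rw [add_mul] at h1
    exact sub_le_iff_le_add'.2 (h1.trans (add_le_add h2 h3))

/-- An order continuous irreducible element is not nilpotent. -/
theorem pow_ne_zero_of_irreducible (hA : AxiomA1 A) {a : A} (ha : a ∈ orderContinuous A)
    (hirr : IrreducibleElt a) (ha0 : a ≠ 0) (n : ℕ) : a ^ (n + 1) ≠ 0 ∧
      a ^ (n + 1) ∈ orderContinuous A := by
  induction n with
  | zero => simpa using ⟨ha0, ha⟩
  | succ n ih =>
    rw [pow_succ' a (n + 1)]
    refine ⟨fun h => ?_, hA.orderRegular _ ha _ ih.2⟩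
    obtain ⟨p, hp, hap, hpa⟩ := hA.disjunctiveProduct a ha _ ih.2 h
    rcases hirr.2 p hp (by rw [mul_assoc, hap, mul_zero]) with h | h
    · rw [h, sub_zero, one_mul] at hpa
      exact ih.1 hpa
    · rw [h, mul_one] at hap
      exact ha0 hap

variable [NormedAlgebra ℂ A]

theorem orderContinuous_smul [PosSMulMono ℝ A] {x : A} (hx : x ∈ orderContinuous A) {t : ℝ}
    (ht : 0 ≤ t) : t • x ∈ orderContinuous A := by
  obtain ⟨n, hn⟩ := exists_nat_ge t
  have key : ∀ n : ℕ, (n : ℝ) • x ∈ orderContinuous A := by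
    intro n
    induction n with
    | zero => simpa using zero_mem_orderContinuous hx
    | succ n ih =>
      rw [Nat.cast_succ, add_smul, one_smul]
      exact orderContinuous_add ih hx
  refine orderContinuous_of_le (key n) (smul_nonneg ht hx.1) ?_
  have := smul_nonneg (sub_nonneg.2 hn) hx.1
  rwa [sub_smul, sub_nonneg] at this

/-- A left eigenelement of an irreducible element is strictly positive on order idempotents. -/
theorem eq_zero_of_mul_eq_zero_of_left_eigen (hA : AxiomA1 A) {a x : A} (ha : a ∈ orderContinuous A)
    (hirr : IrreducibleElt a) (hx : x ∈ orderContinuous A) (hx0 : x ≠ 0) {r : ℝ}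
    (hxa : x * a = r • x) {p : A} (hp : p ∈ orderIdempotents A) (hxp : x * p = 0) : p = 0 := by
  obtain ⟨s, hs, hxs, hmax⟩ := exists_max_right_annihilator hA.dedekindComplete hx
  have has : a * s ∈ orderContinuous A := by
    refine orderContinuous_of_le ha (mul_nonneg ha.1 hs.1) ?_
    simpa using mul_le_mul_of_nonneg_left hs.2.1 ha.1
  have h0 : x * (a * s) = 0 := by rw [← mul_assoc, hxa, smul_mul_assoc, hxs, smul_zero]
  obtain ⟨q, hq, hxq, hqa⟩ := hA.disjunctiveProduct x hx _ has h0
  have hqs := hmax q hq hxq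
  -- Maximality gives `q ≤ s`, so `1 - s ≤ 1 - q`, which kills `a * s`: the maximal annihilator is
  -- invariant under `a`.
  have hinv : (1 - s) * a * s = 0 := by
    refine le_antisymm ?_ (mul_nonneg (mul_nonneg (sub_nonneg.2 hs.2.1) ha.1) hs.1)
    rw [← hqa, mul_assoc]
    exact mul_le_mul_of_nonneg_right (sub_le_sub_left hqs _) has.1
  rcases hirr.2 s hs hinv with h | h
  · exact le_antisymm (h ▸ hmax p hp hxp) hp.1
  · rw [h, mul_one] at hxs
    exact absurd hxs hx0

/-- A right eigenelement of an irreducible element is strictly positive on order idempotents. -/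
theorem eq_zero_of_mul_eq_zero_of_right_eigen (hA : AxiomA1 A) {a x : A}
    (ha : a ∈ orderContinuous A)
    (hirr : IrreducibleElt a) (hx : x ∈ orderContinuous A) (hx0 : x ≠ 0) {r : ℝ}
    (hax : a * x = r • x) {p : A} (hp : p ∈ orderIdempotents A) (hpx : p * x = 0) : p = 0 := by
  obtain ⟨s, hs, hsx, hmax⟩ := exists_max_left_annihilator hA.dedekindComplete hx
  have hsa : s * a ∈ orderContinuous A := by
    refine orderContinuous_of_le ha (mul_nonneg hs.1 ha.1) ?_
    simpa using mul_le_mul_of_nonneg_right hs.2.1 ha.1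
  have h0 : s * a * x = 0 := by rw [mul_assoc, hax, mul_smul_comm, hsx, smul_zero]
  obtain ⟨q, hq, haq, hqx⟩ := hA.disjunctiveProduct _ hsa x hx h0
  have hqs := hmax _ (one_sub_mem_orderIdempotents hq) hqx
  have hs' := one_sub_mem_orderIdempotents hs
  have hinv : (1 - (1 - s)) * a * (1 - s) = 0 := by
    rw [sub_sub_cancel]
    refine le_antisymm ?_ (mul_nonneg hsa.1 hs'.1)
    rw [← haq]
    exact mul_le_mul_of_nonneg_left (sub_le_comm.1 hqs) hsa.1
  rcases hirr.2 _ hs' hinv with h | h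
  · rw [sub_eq_zero] at h
    rw [← h, one_mul] at hsx
    exact absurd hsx hx0
  · rw [sub_eq_self] at h
    exact le_antisymm (h ▸ hmax p hp hpx) hp.1

theorem mul_ne_zero_of_eigen (hA : AxiomA1 A) {a x y : A} (ha : a ∈ orderContinuous A)
    (hirr : IrreducibleElt a) (hx : x ∈ orderContinuous A) (hx0 : x ≠ 0) {r : ℝ}
    (hxa : x * a = r • x) (hy : y ∈ orderContinuous A) (hy0 : y ≠ 0) : x * y ≠ 0 := by
  intro h
  obtain ⟨p, hp, hxp, hpy⟩ := hA.disjunctiveProduct x hx y hy h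
  rw [eq_zero_of_mul_eq_zero_of_left_eigen hA ha hirr hx hx0 hxa hp hxp, sub_zero, one_mul] at hpy
  exact hy0 hpy

theorem mul_ne_zero_of_right_eigen (hA : AxiomA1 A) {a x y : A} (ha : a ∈ orderContinuous A)
    (hirr : IrreducibleElt a) (hx : x ∈ orderContinuous A) (hx0 : x ≠ 0) {r : ℝ}
    (hax : a * x = r • x) (hy : y ∈ orderContinuous A) (hy0 : y ≠ 0) : y * x ≠ 0 := by
  intro h
  obtain ⟨p, hp, hyp, hpx⟩ := hA.disjunctiveProduct y hy x hx h
  have := eq_zero_of_mul_eq_zero_of_right_eigen hA ha hirr hx hx0 hax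
    (one_sub_mem_orderIdempotents hp) hpx
  rw [← sub_eq_zero.1 this, mul_one] at hyp
  exact hy0 hyp

end Order

/-! ### Algebra of the square root iteration. -/

section SqrtIteration

variable {A : Type*} [NormedRing A] [NormedAlgebra ℂ A]

/-- The iteration for `1 - √(1 - z)`. -/
noncomputable def sqrtIter (z : A) : ℕ → A
  | 0 => 0
  | n + 1 => (1 / 2 : ℝ) • (sqrtIter z n * sqrtIter z n + z)

/-- The scalar iteration that dominates `sqrtIter`. -/
noncomputable def sqrtIterReal : ℕ → ℝ
  | 0 => 0
  | n + 1 => (1 / 2 : ℝ) * (sqrtIterReal n * sqrtIterReal n + 1)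

theorem sqrtIterReal_mem (n : ℕ) : 0 ≤ sqrtIterReal n ∧ sqrtIterReal n ≤ 1 := by
  induction n with
  | zero => simp [sqrtIterReal]
  | succ n ih =>
    obtain ⟨h0, h1⟩ := ih
    simp only [sqrtIterReal]
    constructor <;> nlinarith

theorem sqrtIterReal_mono : Monotone sqrtIterReal := by
  refine monotone_nat_of_le_succ fun n => ?_
  simp only [sqrtIterReal]
  nlinarith [sq_nonneg (sqrtIterReal n - 1)]

theorem sqrtIter_commute {z y : A} (h : Commute z y) (n : ℕ) : Commute (sqrtIter z n) y := by
  induction n with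
  | zero => exact Commute.zero_left y
  | succ n ih => exact ((ih.mul_left ih).add_left h).smul_left _

theorem mul_sqrtIter {z p : A} (hpz : p * z = z) (n : ℕ) : p * sqrtIter z n = sqrtIter z n := by
  induction n with
  | zero => exact mul_zero p
  | succ n ih => simp only [sqrtIter]; rw [mul_smul_comm, mul_add, ← mul_assoc, ih, hpz]

theorem sqrtIter_mul {z p : A} (hzp : z * p = z) (n : ℕ) : sqrtIter z n * p = sqrtIter z n := by
  induction n with
  | zero => exact zero_mul p
  | succ n ih => simp only [sqrtIter]; rw [smul_mul_assoc, add_mul, mul_assoc, ih, hzp]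

/-- The iterates commute, so a difference of squares factors. For positive `z` the sum factor is
positive, which lets bounds on the increments propagate by induction. -/
theorem sqrtIter_succ_sub {z : A} (n : ℕ) : sqrtIter z (n + 2) - sqrtIter z (n + 1) =
    (1 / 2 : ℝ) • ((sqrtIter z (n + 1) + sqrtIter z n) * (sqrtIter z (n + 1) - sqrtIter z n)) := by
  have hz : ∀ m, Commute (sqrtIter z m) z := fun m => sqrtIter_commute (Commute.refl z) m
  have h : Commute (sqrtIter z (n + 1)) (sqrtIter z n) :=
    (sqrtIter_commute (hz n).symm (n + 1))
  rw [← h.mul_self_sub_mul_self_eq]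
  change (1 / 2 : ℝ) • (sqrtIter z (n + 1) * sqrtIter z (n + 1) + z) -
    (1 / 2 : ℝ) • (sqrtIter z n * sqrtIter z n + z) = _
  module

end SqrtIteration

/-! ### Order bounds and norm convergence of the iteration. -/

section Order

theorem mul_self_le_mul_self_of_commute {A : Type*} [NormedRing A] [PartialOrder A]
    [IsOrderedRing A] {u v : A} (h : Commute u v) (hu : 0 ≤ u) (huv : u ≤ v) :
    u * u ≤ v * v := by
  have := mul_nonneg (add_nonneg (hu.trans huv) hu) (sub_nonneg.2 huv)
  rwa [← h.symm.mul_self_sub_mul_self_eq, sub_nonneg] at this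

theorem sqrtIter_nonneg {A : Type*} [NormedRing A] [NormedAlgebra ℂ A] [PartialOrder A]
    [IsOrderedRing A] [PosSMulMono ℝ A] {z : A} (hz : 0 ≤ z) (n : ℕ) : 0 ≤ sqrtIter z n := by
  induction n with
  | zero => exact le_rfl
  | succ n ih => exact smul_nonneg (by norm_num) (add_nonneg (mul_nonneg ih ih) hz)

/-- The element `p - y` is a fixed point of the iteration with `z = p - y * y`, and squaring is
monotone on commuting positive elements. -/
theorem sqrtIter_le {A : Type*} [NormedRing A] [NormedAlgebra ℂ A] [PartialOrder A]
    [IsOrderedRing A] [PosSMulMono ℝ A] {y p : A} (hp : p * p = p) (hpy : p * y = y) (hyp : y * p = y)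
    (hz : 0 ≤ p - y * y) (h2 : y ≤ p) (n : ℕ) : sqrtIter (p - y * y) n ≤ p - y := by
  have hpz : p * (p - y * y) = p - y * y := by rw [mul_sub, hp, ← mul_assoc, hpy]
  have hzp : (p - y * y) * p = p - y * y := by rw [sub_mul, hp, mul_assoc, hyp]
  induction n with
  | zero => exact sub_nonneg.2 h2
  | succ n ih =>
    have hzy : Commute (p - y * y) y := by
      refine Commute.sub_left ?_ ((Commute.refl y).mul_left (Commute.refl y))
      exact hpy.trans hyp.symm
    have hc : Commute (sqrtIter (p - y * y) n) (p - y) := by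
      refine Commute.sub_right ?_ (sqrtIter_commute hzy n)
      exact (sqrtIter_mul hzp n).trans (mul_sqrtIter hpz n).symm
    have h3 := mul_self_le_mul_self_of_commute hc (sqrtIter_nonneg hz n) ih
    have h4 : p - y = (1 / 2 : ℝ) • ((p - y) * (p - y) + (p - y * y)) := by
      simp only [mul_sub, sub_mul, hp, hpy, hyp]
      module
    rw [h4]
    exact smul_le_smul_of_nonneg_left (add_le_add_left h3 _) (by norm_num)

theorem sqrtIter_sub_le {A : Type*} [NormedRing A] [NormedAlgebra ℂ A] [PartialOrder A]
    [IsOrderedRing A] [PosSMulMono ℝ A] {z p : A} (hp : p * p = p) (hp0 : 0 ≤ p) (hz : 0 ≤ z) (hzp : z ≤ p) (n : ℕ) :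
    sqrtIter z n ≤ sqrtIterReal n • p ∧ 0 ≤ sqrtIter z (n + 1) - sqrtIter z n ∧
      sqrtIter z (n + 1) - sqrtIter z n ≤ (sqrtIterReal (n + 1) - sqrtIterReal n) • p := by
  have hle : ∀ n, sqrtIter z n ≤ sqrtIterReal n • p := by
    intro n
    induction n with
    | zero => simp [sqrtIter, sqrtIterReal]
    | succ n ih =>
      have h0 := smul_nonneg (sqrtIterReal_mem n).1 hp0
      have := smul_le_smul_of_nonneg_left (add_le_add
        (mul_le_mul ih ih (sqrtIter_nonneg hz n) h0) hzp) (by norm_num : (0 : ℝ) ≤ 1 / 2)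
      refine this.trans (le_of_eq ?_)
      rw [smul_mul_smul_comm, hp, sqrtIterReal]
      module
  refine ⟨hle n, ?_⟩
  induction n with
  | zero =>
    have h0 := smul_nonneg (by norm_num : (0 : ℝ) ≤ 1 / 2) hz
    have h1 := smul_le_smul_of_nonneg_left hzp (by norm_num : (0 : ℝ) ≤ 1 / 2)
    simpa [sqrtIter, sqrtIterReal] using And.intro h0 h1
  | succ n ih =>
    rw [sqrtIter_succ_sub]
    have hs := add_nonneg (sqrtIter_nonneg hz (n + 1)) (sqrtIter_nonneg hz n)
    refine ⟨smul_nonneg (by norm_num) (mul_nonneg hs ih.1), ?_⟩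
    have h1 := add_le_add (hle (n + 1)) (hle n)
    have := smul_le_smul_of_nonneg_left (mul_le_mul h1 ih.2 ih.1
      (hs.trans h1)) (by norm_num : (0 : ℝ) ≤ 1 / 2)
    refine this.trans (le_of_eq ?_)
    rw [← add_smul, smul_mul_smul_comm, hp, smul_smul]
    congr 1
    simp only [sqrtIterReal]
    ring

theorem sqrtIter_sub_le_of_le {A : Type*} [NormedRing A] [NormedAlgebra ℂ A] [PartialOrder A]
    [IsOrderedRing A] [PosSMulMono ℝ A] {z p : A} (hp : p * p = p) (hp0 : 0 ≤ p) (hz : 0 ≤ z) (hzp : z ≤ p) {m n : ℕ} (hmn : m ≤ n) :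
    0 ≤ sqrtIter z n - sqrtIter z m ∧
      sqrtIter z n - sqrtIter z m ≤ (sqrtIterReal n - sqrtIterReal m) • p := by
  induction n, hmn using Nat.le_induction with
  | base => simp
  | succ n hmn ih =>
    have h := (sqrtIter_sub_le hp hp0 hz hzp n).2
    have e : sqrtIter z (n + 1) - sqrtIter z m =
      (sqrtIter z (n + 1) - sqrtIter z n) + (sqrtIter z n - sqrtIter z m) := by abel
    rw [e]
    refine ⟨add_nonneg h.1 ih.1, (add_le_add h.2 ih.2).trans (le_of_eq ?_)⟩
    module

/-- Increments are dominated by those of a bounded monotone scalar sequence times `p`; normality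
turns this into a Cauchy estimate in norm. -/
theorem exists_tendsto_sqrtIter {A : Type*} [NormedRing A] [NormedAlgebra ℂ A] [PartialOrder A]
    [IsOrderedRing A] [PosSMulMono ℝ A] [CompleteSpace A]
    (hN : NormalCone A) {z p : A} (hp : p * p = p)
    (hp0 : 0 ≤ p) (hz : 0 ≤ z) (hzp : z ≤ p) :
    ∃ w : A, Tendsto (sqrtIter z) atTop (𝓝 w) := by
  obtain ⟨C, hC⟩ := hN
  have hbdd : BddAbove (range sqrtIterReal) := ⟨1, by rintro _ ⟨n, rfl⟩; exact (sqrtIterReal_mem n).2⟩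
  have hlim := tendsto_atTop_ciSup sqrtIterReal_mono hbdd
  have hcau := hlim.cauchySeq
  refine cauchySeq_tendsto_of_complete (Metric.cauchySeq_iff'.2 fun ε hε => ?_)
  obtain ⟨N, hN⟩ := Metric.cauchySeq_iff'.1 hcau (ε / (|C| * ‖p‖ + 1)) (by positivity)
  refine ⟨N, fun n hn => ?_⟩
  have h := sqrtIter_sub_le_of_le hp hp0 hz hzp hn
  have h1 := hC _ _ h.1 h.2
  have h2 := hN n hn
  rw [Real.dist_eq, lt_div_iff₀ (by positivity)] at h2
  rw [dist_eq_norm]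
  rw [norm_smul, Real.norm_eq_abs] at h1
  calc _ ≤ C * (|sqrtIterReal n - sqrtIterReal N| * ‖p‖) := h1
    _ ≤ |C| * (|sqrtIterReal n - sqrtIterReal N| * ‖p‖) := by
      gcongr
      exact le_abs_self C
    _ = |sqrtIterReal n - sqrtIterReal N| * (|C| * ‖p‖) := by ring
    _ ≤ |sqrtIterReal n - sqrtIterReal N| * (|C| * ‖p‖ + 1) := by
      gcongr
      linarith
    _ < ε := h2

theorem nonneg_of_forall_nat {A : Type*} [NormedRing A] [NormedAlgebra ℂ A] [PartialOrder A]
    [OrderClosedTopology A] {u v : A} (h : ∀ n : ℕ, 0 ≤ u + (1 / ((n : ℝ) + 1)) • v) : 0 ≤ u := by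
  have h1 : Tendsto (fun n : ℕ => u + (1 / ((n : ℝ) + 1)) • v) atTop (𝓝 (u + (0 : ℝ) • v)) :=
    tendsto_const_nhds.add (tendsto_one_div_add_atTop_nhds_zero_nat.smul_const v)
  rw [zero_smul, add_zero] at h1
  exact ge_of_tendsto' h1 h

end Order

/-! ### Corners of idempotents: positive squares, disjoint parts, scalars. -/

section Corner

variable {A : Type*} [NormedRing A] [NormedAlgebra ℂ A] [PartialOrder A] [IsOrderedRing A]
  [PosSMulMono ℝ A] [OrderClosedTopology A]

/-- In a corner with unit `p`, squares of elements between `-p` and `p` are positive. The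
auxiliary elements are the second moments of a random walk with steps `±1` and drift `y`. -/
theorem mul_self_nonneg_of_abs_le {p y : A} (hp : p * p = p) (hpy : p * y = y) (hyp : y * p = y)
    (h1 : -p ≤ y) (h2 : y ≤ p) : 0 ≤ y * y := by
  have h1' : 0 ≤ p + y := by simpa [sub_eq_add_neg, add_comm] using sub_nonneg.2 h1
  have h2' : 0 ≤ p - y := sub_nonneg.2 h2
  have hp0 : 0 ≤ p := by
    have := smul_nonneg (by norm_num : (0 : ℝ) ≤ 1 / 2) (add_nonneg h1' h2')
    convert this using 1
    module
  have hpyy : p * (y * y) = y * y := by rw [← mul_assoc, hpy]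
  -- This is the expectation of `(j + S_n)²`, where the steps `±1` of the walk `S_n` have weights
  -- `(p ± y) / 2`. Conditioning on the first step gives the induction.
  have key : ∀ (n : ℕ) (j : ℝ),
      0 ≤ (j ^ 2) • p + (2 * j * n) • y + ((n : ℝ) ^ 2) • (y * y) + (n : ℝ) • (p - y * y) := by
    intro n
    induction n with
    | zero =>
      intro j
      simpa using smul_nonneg (sq_nonneg j) hp0
    | succ n ih =>
      intro j
      have := smul_nonneg (by norm_num : (0 : ℝ) ≤ 1 / 2)
        (add_nonneg (mul_nonneg h1' (ih (j + 1))) (mul_nonneg h2' (ih (j - 1))))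
      convert this using 1
      simp only [mul_add, add_mul, mul_sub, sub_mul, mul_smul_comm, smul_sub, hp, hpy, hyp, hpyy]
      push_cast
      module
  -- Start at `j = 0`, divide by the square of the number of steps and let that number grow.
  refine nonneg_of_forall_nat (v := p - y * y) fun n => ?_
  have := smul_nonneg (by positivity : (0 : ℝ) ≤ 1 / ((n : ℝ) + 1) ^ 2) (key (n + 1) 0)
  convert this using 1
  push_cast
  match_scalars <;> field_simp <;> ring

/-- In a corner with unit `p`, an element between `-p` and `p` is the difference of two
disjoint positive elements. -/
theorem exists_disjoint_decomposition [CompleteSpace A] (hN : NormalCone A) {p y : A}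
    (hp : p * p = p) (hpy : p * y = y) (hyp : y * p = y) (h1 : -p ≤ y) (h2 : y ≤ p) :
    ∃ f g : A, 0 ≤ f ∧ 0 ≤ g ∧ f ≤ (2 : ℝ) • p ∧ g ≤ (2 : ℝ) • p ∧ f * g = 0 ∧
      f * p = f ∧ (2 : ℝ) • y = f - g := by
  have h1' : 0 ≤ p + y := by simpa [sub_eq_add_neg, add_comm] using sub_nonneg.2 h1
  have h2' : 0 ≤ p - y := sub_nonneg.2 h2
  have hp0 : 0 ≤ p := by
    have := smul_nonneg (by norm_num : (0 : ℝ) ≤ 1 / 2) (add_nonneg h1' h2')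
    convert this using 1
    module
  have hyy := mul_self_nonneg_of_abs_le hp hpy hyp h1 h2
  have hz : 0 ≤ p - y * y := by
    have := mul_nonneg h1' h2'
    simp only [mul_sub, add_mul, hp, hpy, hyp] at this
    convert this using 1
    abel
  have hpz : p * (p - y * y) = p - y * y := by rw [mul_sub, hp, ← mul_assoc, hpy]
  have hzp' : (p - y * y) * p = p - y * y := by rw [sub_mul, hp, mul_assoc, hyp]
  have hzp : p - y * y ≤ p := sub_le_self _ hyy
  obtain ⟨w, hw⟩ := exists_tendsto_sqrtIter hN hp hp0 hz hzp
  have hw0 : 0 ≤ w := ge_of_tendsto' hw (sqrtIter_nonneg hz)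
  have hwy : w ≤ p - y := le_of_tendsto' hw (sqrtIter_le hp hpy hyp hz h2)
  have hwy' : w ≤ p + y := by
    refine le_of_tendsto' hw fun n => ?_
    have := sqrtIter_le hp (y := -y) (by rw [mul_neg, hpy]) (by rw [neg_mul, hyp])
      (by rwa [neg_mul_neg]) (neg_le.1 h1) n
    rwa [neg_mul_neg, sub_neg_eq_add] at this
  have hpw : p * w = w := by
    refine tendsto_nhds_unique (hw.const_mul p) ?_
    simpa only [mul_sqrtIter hpz] using hw
  have hwp : w * p = w := by
    refine tendsto_nhds_unique (hw.mul_const p) ?_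
    simpa only [sqrtIter_mul hzp'] using hw
  have hcomm : w * y = y * w := by
    have hzy : Commute (p - y * y) y := by
      refine Commute.sub_left ?_ ((Commute.refl y).mul_left (Commute.refl y))
      exact hpy.trans hyp.symm
    refine tendsto_nhds_unique (hw.mul_const y) ?_
    simpa only [(sqrtIter_commute hzy _).eq] using hw.const_mul y
  have hfix : w = (1 / 2 : ℝ) • (w * w + (p - y * y)) := by
    refine tendsto_nhds_unique (hw.comp (tendsto_add_atTop_nat 1)) ?_
    exact ((hw.mul hw).add_const _).const_smul _
  have hfix' : w * w + (p - y * y) = (2 : ℝ) • w := by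
    conv_rhs => rw [hfix]
    module
  -- Here `p - w` plays the role of `|y|`: the fixed point equation says `(p - w)² = y²`. The
  -- witnesses are `|y| + y` and `|y| - y`.
  refine ⟨p - w + y, p - w - y, ?_, ?_, ?_, ?_, ?_, ?_, ?_⟩
  · have := sub_nonneg.2 hwy'
    rwa [add_sub_right_comm] at this
  · have := sub_nonneg.2 hwy
    rwa [sub_right_comm] at this
  · rw [two_smul]
    exact add_le_add (sub_le_self _ hw0) h2
  · rw [two_smul, sub_eq_add_neg (p - w) y]
    exact add_le_add (sub_le_self _ hw0) (neg_le.1 h1)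
  · have : (p - w + y) * (p - w - y) = w * w + (p - y * y) - (2 : ℝ) • w := by
      simp only [mul_sub, sub_mul, add_mul, hp, hpw, hwp, hpy, hyp, hcomm]
      module
    rw [this, hfix', sub_self]
  · rw [add_mul, sub_mul, hp, hwp, hyp]
  · module

/-- If the positive part of the corner with unit `p` has no zero divisors below multiples of `p`,
then it contains only multiples of `p`. -/
theorem exists_eq_smul_of_no_zero_divisors [CompleteSpace A] (hN : NormalCone A) {p x : A}
    (hp : p * p = p) (hp0 : 0 < p) (hpx : p * x = x) (hxp : x * p = x)
    (hdiv : ∀ f g : A, 0 ≤ f → 0 ≤ g → f ≤ (2 : ℝ) • p → g ≤ (2 : ℝ) • p → f * p = f →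
      f * g = 0 → f = 0 ∨ g = 0) {r : ℝ} (hx0 : 0 ≤ x) (hxr : x ≤ r • p) :
    ∃ α : ℝ, x = α • p := by
  have hcancel : ∀ s t : ℝ, s • p ≤ t • p → s ≤ t := by
    intro s t hst
    by_contra! h
    have h1 : 0 < s - t := sub_pos.2 h
    rw [← sub_nonneg, ← sub_smul] at hst
    have h2 := smul_nonneg (inv_nonneg.2 h1.le) hst
    have h3 : (s - t)⁻¹ • (t - s) • p = -p := by
      rw [smul_smul, ← neg_sub s t, mul_neg, inv_mul_cancel₀ h1.ne', neg_smul, one_smul]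
    rw [h3] at h2
    exact hp0.not_ge (neg_nonneg.1 h2)
  have hcont : Continuous fun t : ℝ => t • p := continuous_id.smul continuous_const
  let L : Set ℝ := {t | t • p ≤ x}
  let U : Set ℝ := {t | x ≤ t • p}
  have hL : IsClosed L := isClosed_le hcont continuous_const
  have hU : IsClosed U := isClosed_le continuous_const hcont
  have hL0 : (0 : ℝ) ∈ L := by simpa [L] using hx0
  have hLb : BddAbove L := ⟨r, fun t ht => hcancel _ _ (le_trans ht hxr)⟩
  have hUb : BddBelow U := ⟨0, fun t ht => hcancel _ _ (le_trans hL0 ht)⟩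
  have hα := hL.csSup_mem ⟨0, hL0⟩ hLb
  have hβ := hU.csInf_mem ⟨r, hxr⟩ hUb
  set α := sSup L
  set β := sInf U
  have hα' : α • p ≤ x := hα
  have hβ' : x ≤ β • p := hβ
  have hle : α ≤ β := hcancel _ _ (hα'.trans hβ')
  rcases hle.eq_or_lt with h | h
  · exact ⟨α, le_antisymm (h ▸ hβ') hα'⟩
  exfalso
  have hh : 0 < (β - α) / 2 := by linarith
  have hh2 : 0 ≤ ((β - α) / 2)⁻¹ := (inv_pos.2 hh).le
  -- If the best constants satisfy `α < β`, recentre `x` at their midpoint and rescale into `[-p,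
  -- p]`. Vanishing of `f` or of `g` puts the midpoint in `U` or in `L`, improving `β` or `α`.
  obtain ⟨f, g, hf, hg, hfp, hgp, hfg, hfp', hy⟩ := exists_disjoint_decomposition hN
    (y := ((β - α) / 2)⁻¹ • (x - ((α + β) / 2) • p)) hp
    (by rw [mul_smul_comm, mul_sub, hpx, mul_smul_comm, hp])
    (by rw [smul_mul_assoc, sub_mul, hxp, smul_mul_assoc, hp])
    (by
      have := smul_le_smul_of_nonneg_left (sub_le_sub_right hα' (((α + β) / 2) • p)) hh2
      refine le_trans (le_of_eq ?_) this
      rw [← sub_smul, smul_smul, ← neg_one_smul ℝ p]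
      congr 1
      field_simp
      ring)
    (by
      have := smul_le_smul_of_nonneg_left (sub_le_sub_right hβ' (((α + β) / 2) • p)) hh2
      refine le_trans this (le_of_eq ?_)
      rw [← sub_smul, smul_smul]
      conv_rhs => rw [← one_smul ℝ p]
      congr 1
      field_simp
      ring)
  have hxe : x = ((α + β) / 2) • p + ((β - α) / 4) • (f - g) := by
    rw [← hy, smul_smul, smul_smul]
    have : (β - α) / 4 * 2 * ((β - α) / 2)⁻¹ = 1 := by
      have : β - α ≠ 0 := by linarith
      field_simp
      ring
    rw [this]
    module
  rcases hdiv f g hf hg hfp hgp hfp' hfg with h0 | h0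
  · have : (α + β) / 2 ∈ U := by
      change x ≤ _
      rw [hxe, h0, zero_sub, smul_neg]
      simpa using smul_nonneg (by linarith : 0 ≤ (β - α) / 4) hg
    linarith [csInf_le hUb this]
  · have : (α + β) / 2 ∈ L := by
      change _ ≤ x
      rw [hxe, h0, sub_zero]
      simpa using smul_nonneg (by linarith : 0 ≤ (β - α) / 4) hf
    linarith [le_csSup hLb this]

end Corner

/-! ### Spectral radius and growth of powers. -/

section Resolvent

variable {A : Type*} [NormedRing A] [NormedAlgebra ℂ A]

theorem algebraMap_ofReal_eq (l : ℝ) : algebraMap ℂ A (l : ℂ) = l • (1 : A) := by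
  rw [Algebra.algebraMap_eq_smul_one]
  exact Complex.coe_smul l (1 : A)

theorem specRad_nonneg (a : A) : 0 ≤ specRad a := ENNReal.toReal_nonneg

variable [CompleteSpace A]

/-- Gelfand's formula compares the powers eventually with a geometric series of ratio `s / l`, for
any `s` strictly between. -/
theorem summable_norm_pow_of_specRad_lt {a : A} {l : ℝ} (hl : specRad a < l) :
    Summable fun n : ℕ => ‖(l⁻¹ • a) ^ n‖ := by
  obtain ⟨s, hs, hsl⟩ := exists_between hl
  have hs0 : 0 < s := (specRad_nonneg a).trans_lt hs
  have hl0 : 0 < l := hs0.trans hsl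
  have hfin : spectralRadius ℂ a ≠ ⊤ := by
    refine ne_top_of_le_ne_top ?_ (spectrum.spectralRadius_le_pow_nnnorm_pow_one_div ℂ a 0)
    simp [ENNReal.mul_eq_top]
  have h1 : spectralRadius ℂ a < ENNReal.ofReal s := by
    rwa [ENNReal.lt_ofReal_iff_toReal_lt hfin]
  have h2 := (spectrum.pow_norm_pow_one_div_tendsto_nhds_spectralRadius a).eventually_lt_const h1
  refine Summable.of_norm_bounded_eventually_nat (g := fun n => (s / l) ^ n)
    (summable_geometric_of_lt_one (by positivity) ((div_lt_one hl0).2 hsl)) ?_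
  filter_upwards [h2, eventually_gt_atTop 0] with n hn hn0
  rw [ENNReal.ofReal_lt_ofReal_iff hs0] at hn
  have h3 : ‖a ^ n‖ ≤ s ^ n := by
    have := pow_le_pow_left₀ (by positivity) hn.le n
    rwa [one_div, Real.rpow_inv_natCast_pow (norm_nonneg _) hn0.ne'] at this
  rw [norm_norm, smul_pow, norm_smul, norm_pow, norm_inv, Real.norm_of_nonneg hl0.le, div_pow,
    inv_pow, div_eq_inv_mul]
  gcongr

theorem specRad_le_of_norm_pow_le {b : A} {l M : ℝ} (hl : 0 < l) (h : ∀ n : ℕ, ‖b ^ n‖ ≤ M * l ^ n) :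
    specRad b ≤ l := by
  have hz : ∀ z ∈ spectrum ℂ b, ‖z‖ ≤ l := by
    intro z hz
    by_contra! hlt
    have hq : 1 < ‖z‖ / l := (one_lt_div hl).2 hlt
    obtain ⟨n, hn⟩ := pow_unbounded_of_one_lt (M * ‖(1 : A)‖) hq
    have h1 := spectrum.norm_le_norm_mul_of_mem (spectrum.pow_mem_pow b n hz)
    rw [norm_pow] at h1
    rw [div_pow, lt_div_iff₀ (by positivity)] at hn
    have h2 := mul_le_mul_of_nonneg_right (h n) (norm_nonneg (1 : A))
    nlinarith
  refine ENNReal.toReal_le_of_le_ofReal hl.le (iSup₂_le fun z hz' => ?_)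
  rw [← ENNReal.ofReal_coe_nnreal, coe_nnnorm]
  exact ENNReal.ofReal_le_ofReal (hz z hz')

end Resolvent

/-! ### Positivity of the resolvent. -/

section OrderedResolvent

theorem inverse_eq_of_mul_eq_one {R : Type*} [Ring R] {x y : R} (h1 : x * y = 1) (h2 : y * x = 1) :
    Ring.inverse x = y :=
  Ring.inverse_unit (⟨x, y, h1, h2⟩ : Rˣ)

/-- The hypothesis reads `l R = 1 + b R`, whence `1 ≤ l R` and `b R ≤ l R`; iterate. A positive
right inverse thus controls the growth of powers. -/
theorem pow_le_smul_of_mul_eq_one {A : Type*} [NormedRing A] [NormedAlgebra ℂ A] [PartialOrder A]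
    [IsOrderedRing A] [PosSMulMono ℝ A] {b R : A} (hb : 0 ≤ b) (hR : 0 ≤ R) {l : ℝ} (hl : 0 ≤ l)
    (h : (l • (1 : A) - b) * R = 1) (n : ℕ) : b ^ n ≤ l ^ (n + 1) • R := by
  have hR1 : l • R = 1 + b * R := by
    rw [sub_mul, smul_mul_assoc, one_mul] at h
    rw [← h]
    abel
  induction n with
  | zero =>
    rw [pow_zero, zero_add, pow_one, hR1]
    exact le_add_of_nonneg_right (mul_nonneg hb hR)
  | succ n ih =>
    have h1 : b * R ≤ l • R := by
      rw [hR1]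
      exact le_add_of_nonneg_left zero_le_one
    calc b ^ (n + 1) = b * b ^ n := pow_succ' b n
      _ ≤ b * l ^ (n + 1) • R := mul_le_mul_of_nonneg_left ih hb
      _ = l ^ (n + 1) • (b * R) := mul_smul_comm _ _ _
      _ ≤ l ^ (n + 1) • (l • R) := smul_le_smul_of_nonneg_left h1 (by positivity)
      _ = l ^ (n + 1 + 1) • R := by rw [smul_smul, ← pow_succ]

variable {A : Type*} [NormedRing A] [NormedAlgebra ℂ A] [CompleteSpace A] [PartialOrder A]
  [IsOrderedRing A] [PosSMulMono ℝ A] [OrderClosedTopology A]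

/-- Beyond the spectral radius of `a`, the resolvent of an element dominated by `a` is given by the
Neumann series, and is positive. -/
theorem neumann_of_le (hN : NormalCone A) {a b : A} (hb : 0 ≤ b) (hba : b ≤ a) {l : ℝ}
    (hl : specRad a < l) :
    Summable (fun n : ℕ => (l⁻¹ • b) ^ n) ∧ 0 ≤ l⁻¹ • ∑' n : ℕ, (l⁻¹ • b) ^ n ∧
    (l • (1 : A) - b) * (l⁻¹ • ∑' n : ℕ, (l⁻¹ • b) ^ n) = 1 ∧
    (l⁻¹ • ∑' n : ℕ, (l⁻¹ • b) ^ n) * (l • (1 : A) - b) = 1 := by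
  obtain ⟨C, hC⟩ := hN
  have hl0 : 0 < l := (specRad_nonneg a).trans_lt hl
  have hli : 0 ≤ l⁻¹ := (inv_pos.2 hl0).le
  have hx : 0 ≤ l⁻¹ • b := smul_nonneg hli hb
  have hxa : l⁻¹ • b ≤ l⁻¹ • a := smul_le_smul_of_nonneg_left hba hli
  have hs : Summable (fun n : ℕ => (l⁻¹ • b) ^ n) :=
    Summable.of_norm_bounded ((summable_norm_pow_of_specRad_lt hl).mul_left C)
      fun n => hC _ _ (pow_nonneg hx n) (pow_le_pow_left₀ hx hxa n)
  have hlb : l • (1 : A) - b = l • (1 - l⁻¹ • b) := by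
    rw [smul_sub, smul_smul, mul_inv_cancel₀ hl0.ne', one_smul]
  refine ⟨hs, smul_nonneg hli (tsum_nonneg fun n => pow_nonneg hx n), ?_, ?_⟩
  · rw [hlb, smul_mul_smul_comm, mul_inv_cancel₀ hl0.ne', one_smul, hs.one_sub_mul_tsum_pow]
  · rw [hlb, smul_mul_smul_comm, inv_mul_cancel₀ hl0.ne', one_smul, hs.tsum_pow_mul_one_sub]

theorem inverse_eq_neumann (hN : NormalCone A) {a b : A} (hb : 0 ≤ b) (hba : b ≤ a) {l : ℝ}
    (hl : specRad a < l) :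
    Ring.inverse (l • (1 : A) - b) = l⁻¹ • ∑' n : ℕ, (l⁻¹ • b) ^ n :=
  inverse_eq_of_mul_eq_one (neumann_of_le hN hb hba hl).2.2.1 (neumann_of_le hN hb hba hl).2.2.2

/-- The factor `a` makes every term of the Neumann series order continuous; the unit itself is not
assumed to be so. -/
theorem mul_inverse_mem_orderContinuous (hA : AxiomA1 A) (hN : NormalCone A) {a : A}
    (ha : a ∈ orderContinuous A) {l : ℝ} (hl : specRad a < l) :
    a * Ring.inverse (l • (1 : A) - a) ∈ orderContinuous A := by
  have hl0 : 0 < l := (specRad_nonneg a).trans_lt hl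
  have hli : 0 ≤ l⁻¹ := (inv_pos.2 hl0).le
  rw [inverse_eq_neumann hN ha.1 le_rfl hl, mul_smul_comm]
  refine orderContinuous_smul ?_ hli
  have h1 := (neumann_of_le hN ha.1 le_rfl hl).1.hasSum.mul_left a
  refine hA.isClosed.mem_of_tendsto h1.tendsto_sum_nat (Eventually.of_forall fun n => ?_)
  have hterm : ∀ n : ℕ, a * (l⁻¹ • a) ^ n ∈ orderContinuous A := by
    intro n
    induction n with
    | zero => simpa using ha
    | succ n ih =>
      rw [pow_succ, ← mul_assoc]
      exact hA.orderRegular _ ih _ (orderContinuous_smul ha hli)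
  induction n with
  | zero => simpa using zero_mem_orderContinuous ha
  | succ n ih =>
    rw [Finset.sum_range_succ]
    exact orderContinuous_add ih (hterm n)

theorem inverse_nonneg_of_isUnit (hN : NormalCone A) {a b : A} (hb : 0 ≤ b) (hba : b ≤ a)
    {r : ℝ} (hr : specRad a ≤ r) (hu : IsUnit (r • (1 : A) - b)) :
    0 ≤ Ring.inverse (r • (1 : A) - b) := by
  obtain ⟨U, hU⟩ := hu
  have hc : ContinuousAt (fun l : ℝ => l • (1 : A) - b) r := by fun_prop
  have h1 : ContinuousAt Ring.inverse (r • (1 : A) - b) := hU ▸ NormedRing.inverse_continuousAt U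
  have h2 : Tendsto (fun l : ℝ => Ring.inverse (l • (1 : A) - b)) (𝓝[>] r)
      (𝓝 (Ring.inverse (r • (1 : A) - b))) :=
    (Tendsto.comp h1 hc).mono_left nhdsWithin_le_nhds
  refine ge_of_tendsto h2 ?_
  filter_upwards [self_mem_nhdsWithin] with l hl
  have hl' : specRad a < l := hr.trans_lt hl
  rw [inverse_eq_neumann hN hb hba hl']
  exact (neumann_of_le hN hb hba hl').2.1

/-- If `r` belongs to the resolvent set of a positive element and its spectral radius is at most
`r`, then the spectral radius of every element below it is less than `r`. -/
theorem specRad_lt_of_isUnit (hN : NormalCone A) {a b b' : A} (hb : 0 ≤ b) (hbb : b ≤ b')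
    (hba : b' ≤ a) {r : ℝ} (hr0 : 0 < r) (hr : specRad a ≤ r)
    (hu : IsUnit (r • (1 : A) - b')) : specRad b < r := by
  have hb' := hb.trans hbb
  have hV := inverse_nonneg_of_isUnit hN hb' hba hr hu
  have hVm := Ring.mul_inverse_cancel _ hu
  set V := Ring.inverse (r • (1 : A) - b')
  -- Expanding the resolvent around `r` to the left gives `V * ∑ ((r - l) V) ^ n`, whose terms are
  -- all positive.
  obtain ⟨l, hl0, hlr, hlV⟩ : ∃ l : ℝ, 0 < l ∧ l < r ∧ (r - l) * ‖V‖ < 1 := by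
    have h1 : ContinuousAt (fun l : ℝ => (r - l) * ‖V‖) r := by fun_prop
    have h2 : ∀ᶠ l in 𝓝 r, (r - l) * ‖V‖ < 1 := h1.eventually_lt_const (by simp)
    have h3 : ∀ᶠ l in 𝓝[<] r, (0 < l ∧ l < r ∧ (r - l) * ‖V‖ < 1) := by
      filter_upwards [h2.filter_mono nhdsWithin_le_nhds, self_mem_nhdsWithin,
        (lt_mem_nhds hr0).filter_mono nhdsWithin_le_nhds] with l a b c using ⟨c, b, a⟩
    exact h3.exists
  have hrl : 0 ≤ r - l := (sub_pos.2 hlr).le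
  have hx : 0 ≤ (r - l) • V := smul_nonneg hrl hV
  have hnorm : ‖(r - l) • V‖ < 1 := by rwa [norm_smul, Real.norm_of_nonneg hrl]
  have hs : Summable (fun n : ℕ => ((r - l) • V) ^ n) := summable_geometric_of_norm_lt_one hnorm
  have hT : 0 ≤ ∑' n : ℕ, ((r - l) • V) ^ n := tsum_nonneg fun n => pow_nonneg hx n
  have hT1 := hs.one_sub_mul_tsum_pow
  set T := ∑' n : ℕ, ((r - l) • V) ^ n
  have hR : (l • (1 : A) - b') * (V * T) = 1 := by
    have : l • (1 : A) - b' = (r • (1 : A) - b') - (r - l) • (1 : A) := by module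
    rw [← mul_assoc, this, sub_mul, hVm, smul_mul_assoc, one_mul, hT1]
  have hle := pow_le_smul_of_mul_eq_one hb' (mul_nonneg hV hT) hl0.le hR
  obtain ⟨C, hC⟩ := hN
  refine (specRad_le_of_norm_pow_le (M := C * l * ‖V * T‖) hl0 fun n => ?_).trans_lt hlr
  have h1 := hC _ _ (pow_nonneg hb n) ((pow_le_pow_left₀ hb hbb n).trans (hle n))
  rw [norm_smul, Real.norm_of_nonneg (pow_nonneg hl0.le _)] at h1
  refine h1.trans (le_of_eq ?_)
  ring

end OrderedResolvent

/-! ### Laurent coefficients as one-sided limits. -/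

section Laurent

variable {A : Type*} [NormedRing A] [NormedAlgebra ℂ A]

/-- The formal power series in one variable with given coefficients. -/
noncomputable def seriesOfCoeff (c : ℕ → A) : FormalMultilinearSeries ℂ ℂ A :=
  fun n => ContinuousMultilinearMap.mkPiRing ℂ (Fin n) (c n)

theorem coeff_seriesOfCoeff (c : ℕ → A) (n : ℕ) : (seriesOfCoeff c).coeff n = c n := by
  simp [FormalMultilinearSeries.coeff, seriesOfCoeff]

/-- Near a pole of order at most `k`, the function `(z - z₀) ^ k • R(z, a)` is analytic, with the
Laurent coefficients as its Taylor coefficients. -/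
theorem laurent_hasFPowerSeriesAt {a : A} {z₀ : ℂ} {c : ℤ → A} (hc : IsLaurentExpansion a z₀ c)
    {k : ℕ} (hk : ∀ j : ℤ, j < -(k : ℤ) → c j = 0) :
    HasFPowerSeriesAt (Function.update (fun z => (z - z₀) ^ k • resolvent a z) z₀ (c (-(k : ℤ))))
      (seriesOfCoeff fun n => c ((n : ℤ) - k)) z₀ := by
  rw [hasFPowerSeriesAt_iff']
  obtain ⟨δ, hδ, h⟩ := hc
  filter_upwards [Metric.ball_mem_nhds z₀ hδ] with z hz
  rw [mem_ball_iff_norm] at hz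
  simp only [coeff_seriesOfCoeff]
  by_cases hzz : z = z₀
  · subst hzz
    have := hasSum_single (f := fun n : ℕ => (z - z) ^ n • c ((n : ℤ) - k)) 0
      (fun n hn => by simp [hn])
    simpa using this
  · rw [Function.update_of_ne hzz]
    have hz0 : z - z₀ ≠ 0 := sub_ne_zero.2 hzz
    have h1 := ((h z (norm_pos_iff.2 hz0) hz).2).const_smul ((z - z₀) ^ k)
    have hinj : Function.Injective fun n : ℕ => (n : ℤ) - k := fun m n hmn => by
      simpa using hmn
    rw [← hinj.hasSum_iff] at h1
    · refine h1.congr_fun fun n => ?_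
      simp only [Function.comp]
      rw [smul_smul, ← zpow_natCast _ k, ← zpow_add₀ hz0, ← zpow_natCast _ n]
      congr 2
      ring
    · intro j hj
      rw [hk j, smul_zero, smul_zero]
      by_contra! hlt
      refine hj ⟨(j + k).toNat, ?_⟩
      simp only
      omega

/-- These are the value and the derivative at `r` of the analytic function `(z - r) ^ k • R(z, a)`,
taken along real `l > r`, where order arguments apply. -/
theorem laurent_tendsto [CompleteSpace A] {a : A} {r : ℝ} {c : ℤ → A} (hc : IsLaurentExpansion a (r : ℂ) c)
    {k : ℕ} (hk : ∀ j : ℤ, j < -(k : ℤ) → c j = 0) :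
    Tendsto (fun l : ℝ => (l - r) ^ k • Ring.inverse (l • (1 : A) - a)) (𝓝[>] r)
      (𝓝 (c (-(k : ℤ)))) ∧
    Tendsto (fun l : ℝ => (l - r)⁻¹ • ((l - r) ^ k • Ring.inverse (l • (1 : A) - a) -
      c (-(k : ℤ)))) (𝓝[>] r) (𝓝 (c (1 - k))) := by
  have hps := laurent_hasFPowerSeriesAt hc hk
  have hcoe : Tendsto (fun l : ℝ => (l : ℂ)) (𝓝[>] r) (𝓝[≠] (r : ℂ)) := by
    refine tendsto_nhdsWithin_iff.2
      ⟨(Complex.continuous_ofReal.tendsto r).mono_left nhdsWithin_le_nhds, ?_⟩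
    filter_upwards [self_mem_nhdsWithin] with l hl
    have : l ≠ r := ne_of_gt hl
    simpa using this
  have hval : ∀ l : ℝ, l ≠ r → Function.update (fun z => (z - (r : ℂ)) ^ k • resolvent a z) (r : ℂ)
      (c (-(k : ℤ))) l = (l - r) ^ k • Ring.inverse (l • (1 : A) - a) := by
    intro l hl
    rw [Function.update_of_ne (by simpa using hl), resolvent, algebraMap_ofReal_eq,
      ← Complex.ofReal_sub, ← Complex.ofReal_pow]
    exact Complex.coe_smul _ _
  constructor
  · have h1 := hps.continuousAt.tendsto
    rw [Function.update_self] at h1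
    refine ((h1.mono_left nhdsWithin_le_nhds).comp hcoe).congr' ?_
    filter_upwards [self_mem_nhdsWithin] with l hl
    exact hval l (ne_of_gt hl)
  · have h1 := (hasDerivAt_iff_tendsto_slope.1 hps.hasDerivAt)
    rw [FormalMultilinearSeries.apply_eq_prod_smul_coeff, coeff_seriesOfCoeff,
      Finset.prod_const_one, one_smul, Nat.cast_one] at h1
    refine (h1.comp hcoe).congr' ?_
    filter_upwards [self_mem_nhdsWithin] with l hl
    rw [Function.comp, slope_def_module, hval l (ne_of_gt hl), Function.update_self,
      ← Complex.ofReal_sub, ← Complex.ofReal_inv]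
    exact Complex.coe_smul _ _

end Laurent

/-! ### Perturbation of a non-invertible element. -/

section Perturbation

variable {A : Type*} [NormedRing A] [NormedAlgebra ℂ A] [CompleteSpace A]

/-- Let `m` vanish on the idempotent `u` and be invertible on the complement of `u`. If the
compression of `d` to `u` is a non-zero multiple of `u`, then `m + t • d` is invertible for small
`t > 0`. -/
theorem exists_isUnit_add_smul {m u s d : A} {α : ℝ} (hα : α ≠ 0) (hmu : m * u = 0)
    (hum : u * m = 0) (hms : m * s = 1 - u) (hsm : s * m = 1 - u) (huu : u * u = u)
    (hud : u * d * u = α • u) : ∃ t : ℝ, 0 < t ∧ t ≤ 1 ∧ IsUnit (m + t • d) := by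
  have hu' : (1 - u) * (1 - u) = 1 - u := by simp [mul_sub, sub_mul, huu]
  have hu1 : u * (1 - u) = 0 := by rw [mul_sub, huu, mul_one, sub_self]
  have hu2 : (1 - u) * u = 0 := by rw [sub_mul, huu, one_mul, sub_self]
  -- Compressing `s` to the complement of `u` keeps it a partial inverse and makes `S + u` the
  -- inverse of `m + u`.
  obtain ⟨S, hmS, hSm, huS, hSu⟩ :
      ∃ S : A, m * S = 1 - u ∧ S * m = 1 - u ∧ u * S = 0 ∧ S * u = 0 := by
    refine ⟨(1 - u) * s * (1 - u), ?_, ?_, ?_, ?_⟩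
    · rw [← mul_assoc, ← mul_assoc, mul_sub m 1 u, mul_one, hmu, sub_zero, hms, hu']
    · rw [mul_assoc, sub_mul 1 u m, one_mul, hum, sub_zero, mul_assoc, hsm, hu']
    · rw [← mul_assoc, ← mul_assoc, hu1, zero_mul, zero_mul]
    · rw [mul_assoc, hu2, mul_zero]
  have hunit1 : IsUnit (S + u) := by
    refine ⟨⟨S + u, m + u, ?_, ?_⟩, rfl⟩
    · rw [add_mul, mul_add, mul_add, hSm, hSu, hum, huu]
      abel
    · rw [add_mul, mul_add, mul_add, hmS, hmu, huS, huu]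
      abel
  have hunit2 : ∀ t : ℝ, t ≠ 0 → IsUnit (1 - u + t • u) := by
    have h : ∀ t t' : ℝ, t * t' = 1 → (1 - u + t • u) * (1 - u + t' • u) = 1 := by
      intro t t' htt
      rw [add_mul, mul_add, mul_add, hu', mul_smul_comm, hu2, smul_mul_assoc, hu1,
        smul_mul_smul_comm, htt, huu]
      simp
    intro t ht
    exact ⟨⟨_, 1 - u + t⁻¹ • u, h _ _ (mul_inv_cancel₀ ht), h _ _ (inv_mul_cancel₀ ht)⟩, rfl⟩
  obtain ⟨g, hg⟩ : ∃ g, g = (S + u) * d := ⟨_, rfl⟩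
  have hug : u * g * u = α • u := by
    rw [hg, ← mul_assoc, mul_add, huS, zero_add, huu, hud]
  -- Relative to `1 = (1 - u) + u` this is block triangular with diagonal `1 - u`, `α • u`; the
  -- off-diagonal block squares to zero.
  have hunit3 : IsUnit (1 - u + u * g) := by
    have hnil : u * g * (1 - u) * (u * g * (1 - u)) = 0 := by
      rw [mul_assoc (u * g), ← mul_assoc (1 - u), ← mul_assoc (1 - u), hu2]
      simp
    have h1 : IsUnit (1 + α⁻¹ • (u * g * (1 - u))) := by
      generalize u * g * (1 - u) = N at hnil
      refine ⟨⟨_, 1 - α⁻¹ • N, ?_, ?_⟩, rfl⟩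
      · rw [add_mul, mul_sub, mul_sub, smul_mul_smul_comm, hnil]
        simp
      · rw [sub_mul, mul_add, mul_add, smul_mul_smul_comm, hnil]
        simp
    have h2 : 1 - u + u * g = (1 - u + α • u) * (1 + α⁻¹ • (u * g * (1 - u))) := by
      have e1 : (1 - u) * (u * g * (1 - u)) = 0 := by
        rw [← mul_assoc, ← mul_assoc, hu2, zero_mul, zero_mul]
      have e2 : u * (u * g * (1 - u)) = u * g - α • u := by
        rw [← mul_assoc, ← mul_assoc, huu, mul_sub, mul_one, hug]
      rw [mul_add, mul_one, mul_smul_comm, add_mul, e1, zero_add, smul_mul_assoc, smul_smul,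
        inv_mul_cancel₀ hα, one_smul, e2]
      abel
    rw [h2]
    exact (hunit2 α hα).mul h1
  have hopen : ∀ᶠ t : ℝ in 𝓝 0, IsUnit (1 - u + u * g + t • ((1 - u) * g)) := by
    have hc : ContinuousAt (fun t : ℝ => 1 - u + u * g + t • ((1 - u) * g)) 0 := by fun_prop
    refine hc.eventually_mem (Units.isOpen.mem_nhds ?_)
    simpa using hunit3
  have hev : ∀ᶠ t : ℝ in 𝓝[>] 0,
      0 < t ∧ t < 1 ∧ IsUnit (1 - u + u * g + t • ((1 - u) * g)) := by
    filter_upwards [hopen.filter_mono nhdsWithin_le_nhds, self_mem_nhdsWithin,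
      (gt_mem_nhds (zero_lt_one (α := ℝ))).filter_mono nhdsWithin_le_nhds] with t h1 h2 h3
      using ⟨h2, h3, h1⟩
  obtain ⟨t, ht0, ht1, ht⟩ := hev.exists
  refine ⟨t, ht0, ht1.le, ?_⟩
  -- Rescaling the `u` row by `t⁻¹` removes the degeneracy at `t = 0`: the product tends to the unit
  -- `1 - u + u * g`.
  have hfac : (1 - u + t⁻¹ • u) * (S + u) * (m + t • d) =
      1 - u + u * g + t • ((1 - u) * g) := by
    have e1 : (S + u) * (m + t • d) = 1 - u + t • g := by
      rw [mul_add, add_mul, hSm, hum, add_zero, mul_smul_comm, hg]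
    rw [mul_assoc, e1, add_mul, mul_add, hu', mul_smul_comm, mul_add, smul_mul_assoc, hu1,
      smul_zero, zero_add, smul_mul_smul_comm, inv_mul_cancel₀ ht0.ne', one_smul]
    abel
  rw [← hfac] at ht
  obtain ⟨w, hw⟩ := (hunit2 t⁻¹ (inv_ne_zero ht0.ne')).mul hunit1
  rw [← hw] at ht
  exact (Units.isUnit_units_mul w _).1 ht

end Perturbation

/-! ### The pole at the spectral radius and strict monotonicity. -/

section Pole

variable {A : Type*} [NormedRing A] [NormedAlgebra ℂ A] [CompleteSpace A] [PartialOrder A]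
  [IsOrderedRing A] [PosSMulMono ℝ A] [OrderClosedTopology A]

theorem inverse_sub_spec (hN : NormalCone A) {a : A} (ha : 0 ≤ a) {l : ℝ} (hl : specRad a < l) :
    (l • (1 : A) - a) * Ring.inverse (l • (1 : A) - a) = 1 ∧
      Ring.inverse (l • (1 : A) - a) * (l • (1 : A) - a) = 1 ∧
      0 ≤ Ring.inverse (l • (1 : A) - a) := by
  rw [inverse_eq_neumann hN ha le_rfl hl]
  have h := neumann_of_le hN ha le_rfl hl
  exact ⟨h.2.2.1, h.2.2.2, h.2.1⟩

/-- If the radius were `0`, then `a ^ k ≤ l ^ (k + 1) • R(l, a)` for `l > 0`, and the right side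
tends to `0` as `l` decreases to `0`; but `a` is not nilpotent. -/
theorem specRad_pos_of_pole (hA : AxiomA1 A) (hN : NormalCone A) {a : A}
    (ha : a ∈ orderContinuous A) (hirr : IrreducibleElt a) (ha0 : a ≠ 0) {k : ℕ} {u : A}
    (hu : Tendsto (fun l : ℝ => (l - specRad a) ^ k • Ring.inverse (l • (1 : A) - a))
      (𝓝[>] (specRad a)) (𝓝 u)) : 0 < specRad a := by
  refine (specRad_nonneg a).lt_of_ne fun h0 => ?_
  have hpow := pow_ne_zero_of_irreducible hA ha hirr ha0
  have hk : a ^ k ≤ 0 := by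
    have h1 : Tendsto (fun l : ℝ => (l - specRad a) •
        ((l - specRad a) ^ k • Ring.inverse (l • (1 : A) - a))) (𝓝[>] (specRad a))
        (𝓝 ((0 : ℝ) • u)) := by
      refine Tendsto.smul ?_ hu
      have : Tendsto (fun l : ℝ => l - specRad a) (𝓝 (specRad a)) (𝓝 (specRad a - specRad a)) :=
        tendsto_id.sub_const _
      rw [sub_self] at this
      exact this.mono_left nhdsWithin_le_nhds
    rw [zero_smul] at h1
    refine ge_of_tendsto h1 ?_
    filter_upwards [self_mem_nhdsWithin] with l hl
    have hs := inverse_sub_spec hN ha.1 hl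
    have hl0 : 0 ≤ l := (specRad_nonneg a).trans (le_of_lt hl)
    have := pow_le_smul_of_mul_eq_one ha.1 hs.2.2 hl0 hs.1 k
    rwa [← h0, sub_zero, smul_smul, ← pow_succ']
  have hk0 : a ^ k = 0 := le_antisymm hk (pow_nonneg ha.1 k)
  exact (hpow k).1 (by rw [pow_succ, hk0, zero_mul])

/-- The pole of the resolvent of an order continuous irreducible element at the spectral radius is
simple, and the residue is a positive order continuous idempotent. -/
theorem exists_residue_of_isPole (hA : AxiomA1 A) (hN : NormalCone A) {a : A}
    (ha : a ∈ orderContinuous A) (hirr : IrreducibleElt a) (ha0 : a ≠ 0)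
    (hpole : IsPole a (specRad a : ℂ)) :
    0 < specRad a ∧ ∃ u s : A, u ∈ orderContinuous A ∧ u ≠ 0 ∧ u * u = u ∧
      a * u = specRad a • u ∧ u * a = specRad a • u ∧
      (specRad a • (1 : A) - a) * s = 1 - u ∧ s * (specRad a • (1 : A) - a) = 1 - u := by
  obtain ⟨-, c, hc, k, hk1, hk, hck⟩ := hpole
  obtain ⟨hu, hs⟩ := laurent_tendsto hc hk
  have hr0 := specRad_pos_of_pole hA hN ha hirr ha0 hu
  set r := specRad a with hr
  set u := c (-(k : ℤ))
  have hid : Tendsto (fun l : ℝ => l - r) (𝓝[>] r) (𝓝 0) := by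
    have : Tendsto (fun l : ℝ => l - r) (𝓝 r) (𝓝 (r - r)) := tendsto_id.sub_const _
    rw [sub_self] at this
    exact this.mono_left nhdsWithin_le_nhds
  have hm : Tendsto (fun l : ℝ => l • (1 : A) - a) (𝓝[>] r) (𝓝 (r • (1 : A) - a)) := by
    have : Continuous fun l : ℝ => l • (1 : A) - a := by fun_prop
    exact this.continuousAt.tendsto.mono_left nhdsWithin_le_nhds
  have hpow : ∀ n : ℕ, n ≠ 0 → Tendsto (fun l : ℝ => (l - r) ^ n • (1 : A)) (𝓝[>] r) (𝓝 0) := by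
    intro n hn
    have := (hid.pow n).smul_const (1 : A)
    rwa [zero_pow hn, zero_smul] at this
  have hk0 : k ≠ 0 := by omega
  have hmu : (r • (1 : A) - a) * u = 0 := by
    refine tendsto_nhds_unique (hm.mul hu) ((hpow k hk0).congr' ?_)
    filter_upwards [self_mem_nhdsWithin] with l hl
    rw [mul_smul_comm, (inverse_sub_spec hN ha.1 hl).1]
  have hum : u * (r • (1 : A) - a) = 0 := by
    refine tendsto_nhds_unique (hu.mul hm) ((hpow k hk0).congr' ?_)
    filter_upwards [self_mem_nhdsWithin] with l hl
    rw [smul_mul_assoc, (inverse_sub_spec hN ha.1 hl).2.1]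
  have hau : a * u = r • u := by
    rw [sub_mul, smul_mul_assoc, one_mul, sub_eq_zero] at hmu
    exact hmu.symm
  have hua : u * a = r • u := by
    rw [mul_sub, mul_smul_comm, mul_one, sub_eq_zero] at hum
    exact hum.symm
  have hun : u ∈ orderContinuous A := by
    have h1 : a * u ∈ orderContinuous A := by
      refine hA.isClosed.mem_of_tendsto (hu.const_mul a) ?_
      filter_upwards [self_mem_nhdsWithin] with l hl
      rw [mul_smul_comm]
      exact orderContinuous_smul (mul_inverse_mem_orderContinuous hA hN ha hl)
        (pow_nonneg (sub_nonneg.2 (le_of_lt hl)) k)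
    have h2 := orderContinuous_smul h1 (inv_nonneg.2 hr0.le)
    rwa [hau, smul_smul, inv_mul_cancel₀ hr0.ne', one_smul] at h2
  have hVu : ∀ l : ℝ, r < l → (l - r) • (Ring.inverse (l • (1 : A) - a) * u) = u ∧
      (l • (1 : A) - a) * u = (l - r) • u ∧ u * (l • (1 : A) - a) = (l - r) • u := by
    intro l hl
    have h1 : (l • (1 : A) - a) * u = (l - r) • u := by
      rw [sub_mul, smul_mul_assoc, one_mul, hau, sub_smul]
    have h2 : u * (l • (1 : A) - a) = (l - r) • u := by
      rw [mul_sub, mul_smul_comm, mul_one, hua, sub_smul]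
    refine ⟨?_, h1, h2⟩
    rw [← mul_smul_comm, ← h1, ← mul_assoc, (inverse_sub_spec hN ha.1 hl).2.1, one_mul]
  have huu0 : u * u ≠ 0 := mul_ne_zero_of_eigen hA ha hirr hun hck hua hun hck
  obtain ⟨n, rfl⟩ : ∃ n, k = n + 1 := ⟨k - 1, by omega⟩
  -- The pole has order `n + 1`. Were `n` positive, this limit would be `0`, contradicting `u * u ≠
  -- 0`.
  have hlim : Tendsto (fun l : ℝ => (l - r) ^ n • u) (𝓝[>] r) (𝓝 (u * u)) := by
    refine (hu.mul_const u).congr' ?_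
    filter_upwards [self_mem_nhdsWithin] with l hl
    rw [smul_mul_assoc, pow_succ, mul_smul, (hVu l hl).1]
  have hn : n = 0 := by
    by_contra hn
    refine huu0 (tendsto_nhds_unique hlim ?_)
    have := (hid.pow n).smul_const u
    rwa [zero_pow hn, zero_smul] at this
  subst hn
  have huu : u * u = u := by
    refine tendsto_nhds_unique hlim ?_
    simp
  -- The index is `0`: the constant Laurent coefficient inverts `r - a` modulo `u`.
  refine ⟨hr0, u, c (1 - ((0 + 1 : ℕ) : ℤ)), hun, hck, huu, hau, hua, ?_, ?_⟩
  · refine tendsto_nhds_unique (hm.mul hs) (tendsto_const_nhds.congr' ?_)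
    filter_upwards [self_mem_nhdsWithin] with l hl
    have hl' : l - r ≠ 0 := (sub_pos.2 hl).ne'
    rw [mul_smul_comm, mul_sub, mul_smul_comm, (inverse_sub_spec hN ha.1 hl).1, (hVu l hl).2.1,
      zero_add, pow_one, ← smul_sub, smul_smul, inv_mul_cancel₀ hl', one_smul]
  · refine tendsto_nhds_unique (hs.mul hm) (tendsto_const_nhds.congr' ?_)
    filter_upwards [self_mem_nhdsWithin] with l hl
    have hl' : l - r ≠ 0 := (sub_pos.2 hl).ne'
    rw [smul_mul_assoc, sub_mul, smul_mul_assoc, (inverse_sub_spec hN ha.1 hl).2.1,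
      (hVu l hl).2.2, zero_add, pow_one, ← smul_sub, smul_smul, inv_mul_cancel₀ hl', one_smul]

/-- Strict monotonicity of the spectral radius below an order continuous irreducible element whose
spectral radius is a pole of the resolvent. -/
theorem specRad_lt_of_lt (hA : AxiomA1 A) (hN : NormalCone A) {a b : A} (hb : 0 ≤ b)
    (hba : b < a) (hirr : IrreducibleElt a) (ha : a ∈ orderContinuous A)
    (hpole : IsPole a (specRad a : ℂ)) : specRad b < specRad a := by
  have ha0 : a ≠ 0 := (hb.trans_lt hba).ne'
  obtain ⟨hr0, u, s, hu, hu0, huu, hau, hua, hms, hsm⟩ :=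
    exists_residue_of_isPole hA hN ha hirr ha0 hpole
  set r := specRad a with hr
  have hd0 : 0 ≤ a - b := sub_nonneg.2 hba.le
  have hda : a - b ≤ a := sub_le_self a hb
  have hd : a - b ∈ orderContinuous A := orderContinuous_of_le ha hd0 hda
  have hdne : a - b ≠ 0 := sub_ne_zero.2 hba.ne'
  have hud := hA.orderRegular u hu _ hd
  have hx : u * (a - b) * u ∈ orderContinuous A := hA.orderRegular _ hud _ hu
  have hx0 : u * (a - b) * u ≠ 0 := by
    refine mul_ne_zero_of_right_eigen hA ha hirr hu hu0 hau hud ?_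
    exact mul_ne_zero_of_eigen hA ha hirr hu hu0 hua hd hdne
  obtain ⟨α, hα⟩ : ∃ α : ℝ, u * (a - b) * u = α • u := by
    refine exists_eq_smul_of_no_zero_divisors hN huu (hu.1.lt_of_ne' hu0) ?_ ?_ ?_ hx.1 (r := r) ?_
    · rw [← mul_assoc, ← mul_assoc, huu]
    · rw [mul_assoc, huu]
    · intro f g hf hg hfu hgu hfu' hfg
      have hf' : f ∈ orderContinuous A :=
        orderContinuous_of_le (orderContinuous_smul hu zero_le_two) hf hfu
      have hg' : g ∈ orderContinuous A :=
        orderContinuous_of_le (orderContinuous_smul hu zero_le_two) hg hgu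
      by_contra! h
      refine mul_ne_zero_of_eigen hA ha hirr hf' h.1 (r := r) ?_ hg' h.2 hfg
      rw [← hfu', mul_assoc, hua, mul_smul_comm]
    · have h1 := mul_le_mul_of_nonneg_right (mul_le_mul_of_nonneg_left hda hu.1) hu.1
      rwa [hua, smul_mul_assoc, huu] at h1
  have hα0 : α ≠ 0 := by
    rintro rfl
    exact hx0 (by rw [hα, zero_smul])
  obtain ⟨t, ht0, ht1, ht⟩ := exists_isUnit_add_smul (m := r • (1 : A) - a) hα0
    (by rw [sub_mul, smul_mul_assoc, one_mul, hau, sub_self])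
    (by rw [mul_sub, mul_smul_comm, mul_one, hua, sub_self]) hms hsm huu hα
  -- The intermediate element dominates `b` because `t ≤ 1`, and `r - b'` is the perturbed unit just
  -- found.
  refine specRad_lt_of_isUnit hN (b' := a - t • (a - b)) hb ?_
    (sub_le_self a (smul_nonneg ht0.le hd0)) hr0 le_rfl ?_
  · have h1 := smul_nonneg (sub_nonneg.2 ht1) hd0
    rw [sub_smul, one_smul] at h1
    rw [le_sub_comm]
    exact sub_nonneg.1 h1
  · convert ht using 1
    abel

end Pole

end OBA

theorem theorem36 {A : Type*} [NormedRing A] [NormedAlgebra ℂ A] [CompleteSpace A]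
    [PartialOrder A] [IsOrderedRing A] [PosSMulMono ℝ A] [OrderClosedTopology A]
    (hA : OBA.AxiomA1 A) (hnormal : OBA.NormalCone A)
    (a b : A) (hb : 0 ≤ b) (hba : b < a)
    (hirr : OBA.IrreducibleElt a) (hcont : a ∈ OBA.orderContinuous A)
    (hpole : OBA.IsPole a (OBA.specRad a : ℂ)) :
    ((∃ F : OBA.FredholmAlgebra A, algebraMap ℂ A (OBA.specRad a : ℂ) - a ∈ F.Phi) →
      OBA.specRad b < OBA.specRad a) ∧
    ((∃ J : TwoSidedIdeal A, OBA.Inessential J ∧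
        ∃ x ∈ J, OBA.IsResidue a (OBA.specRad a : ℂ) x) →
      OBA.specRad b < OBA.specRad a) ∧
    (OBA.Inessential (OBA.finiteRank A) → OBA.specRad b < OBA.specRad a) := by
  have h := OBA.specRad_lt_of_lt hA hnormal hb hba hirr hcont hpole
  exact ⟨fun _ => h, fun _ => h, fun _ => h⟩
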